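/- Consider an ergodic Markov decision process with finite state space $\mathcal S$, finite action space $\mathcal A$, nonempty sets $\mathcal A_s\subseteq\mathcal A$ of allowed actions and transition probabilities $P(s'\mid s,a)$; ergodic means that every deterministic stationary policy $\beta$ (a choice of $\beta(s)\in\mathcal A_s$ for every $s$) leads to an irreducible and aperiodic Markov chain. Write $S=|\mathcal S|$ and $A=|\mathcal A|$. Choosing $a_t\in\mathcal A_{s_t}$ in state $s_t$ in slot $t$ gives the reward $r_t=f(s_t,a_t,X_t)$, where the $X_t$ are i.i.d. and $X_t$ is independent of everything that happened up to the choice of $a_t$; given the history up to the choice of $a_t$, the next state $s_{t+1}$ has law $P(\cdot\mid s_t,a_t)$. Let $\mathcal X$ be a set that contains $X_t$ almost surely, let $B(s,a)\ge \sup_{x\in\mathcal X}f(s,a,x)-\inf_{x\in\mathcal X}f(s,a,x)$ be finite upper bounds on the range of the rewards, and let $B_0=\max_{s\in\mathcal S,\,a\in\mathcal A_s}B(s,a)>0$. Let $\mu(s,a)=\mathbb E[f(s,a,X_t)]$ and assume $\mu(s,a)\ge 0$ for all $s\in\mathcal S$, $a\in\mathcal A_s$. For a policy $\beta$ with stationary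 distribution $\pi_\beta$ let $\rho(\beta)=\sum_{s}\pi_\beta(s)\mu(s,\beta(s))$, and let $\rho^*=\max_\beta\rho(\beta)$. Assume that there are at least two policies, that the optimal policy $\beta^*$ is unique, and put $$\Delta_1=\rho^*-\max_{\beta\ne\beta^*}\rho(\beta),\quad \mu_{\max}=\max_{s\in\mathcal S,\,a\in\mathcal A_s}\mu(s,a),\quad \Delta_{\max}=\rho^*-\min_{s\in\mathcal S,\,a\in\mathcal A_s}\mu(s,a),\quad \gamma=\max_{s,s'\in\mathcal S}\|P_*(s',\cdot)-P_*(s,\cdot)\|_{\mathrm{TV}},$$ where $P_*(s,\cdot)=P(\cdot\mid s,\beta^*(s))$ is the transition matrix of $\beta^*$ and $\|\cdot\|_{\mathrm{TV}}$ is the total variation distance (the maximum over events of the difference in probability). Assume $\gamma<1$. The algorithm LPSM knows $P$ and $f$ but not $\mu$. In slot $0$ it chooses any allowed action. In each slot $n\ge1$ it forms the sample means $\theta_n(s,a)=\frac1n\sum_{k=0}^{n-1}f(s,a,X_k)$, computes an optimal solution $\pi_{(n)}$ of the linear program $$\max\ \sum_{s\in\mathcal S}\sum_{a\in\mathcal A_s}\pi(s,a)\theta_n(s,a)\quad\text{s.t.}\quad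 \pi\ge0,\quad \sum_{s}\sum_{a\in\mathcal A_s}\pi(s,a)=1,\quad \sum_{a\in\mathcal A_{s'}}\pi(s',a)=\sum_{s}\sum_{a\in\mathcal A_s}\pi(s,a)P(s'\mid s,a)\ \ \forall s'\in\mathcal S,$$ chooses $\beta_n(s)\in\arg\max_{a\in\mathcal A_s}\pi_{(n)}(s,a)$ for all $s$, and plays $a_n=\beta_n(s_n)$. Then, for every initial distribution of $s_0$, every choice among optimal solutions and maximizers that depends only on the past (and possibly on additional randomness), and every $T\ge0$, the regret of LPSM satisfies $$T\rho^*-\mathbb E\Big[\sum_{t=0}^{T-1}r_t\Big]\ \le\ \left(1+\frac{(1+A)S}{e^{\frac12(\Delta_1/B_0)^2}-1}\right)\left(\frac{\mu_{\max}}{1-\gamma}+\Delta_{\max}\right).$$ -/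

import Mathlib

open MeasureTheory ProbabilityTheory

noncomputable section

/-- A Markov decision process with finite state space `S` and finite action space `A`. The actions
allowed in state `s` are `allowed s`; `trans s a s'` is the probability `P(s' | s, a)`, which is
only constrained (and only ever used) for allowed actions `a`. -/
structure FiniteMDP (S A : Type*) [Fintype S] where
  allowed : S → Finset A
  allowed_nonempty : ∀ s, (allowed s).Nonempty
  trans : S → A → S → ℝ
  trans_nonneg : ∀ s, ∀ a ∈ allowed s, ∀ s', 0 ≤ trans s a s'
  trans_sum : ∀ s, ∀ a ∈ allowed s, ∑ s', trans s a s' = 1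

/-- `π` is a stationary probability distribution of the transition matrix `Q`. -/
def IsStationaryDist {S : Type*} [Fintype S] (Q : Matrix S S ℝ) (π : S → ℝ) : Prop :=
  (∀ s, 0 ≤ π s) ∧ ∑ s, π s = 1 ∧ ∀ s', π s' = ∑ s, π s * Q s s'

open Classical in
/-- The stationary distribution of `Q` (it exists and is unique for the chains of an ergodic MDP;
the value is `0` if there is none). -/
def stationaryDist {S : Type*} [Fintype S] (Q : Matrix S S ℝ) : S → ℝ :=
  if h : ∃ π, IsStationaryDist Q π then h.choose else 0

/-- Aperiodicity: for every state, the possible return times have no common divisor but `1`. -/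
def IsAperiodicChain {S : Type*} [Fintype S] [DecidableEq S] (Q : Matrix S S ℝ) : Prop :=
  ∀ s, ∀ d : ℕ, (∀ n : ℕ, 1 ≤ n → 0 < (Q ^ n) s s → d ∣ n) → d = 1

/-- Total variation distance of two distributions on a finite set:
the maximum over events `E` of `|φ(E) - ψ(E)|`. -/
def tvDistance {S : Type*} [Fintype S] (φ ψ : S → ℝ) : ℝ :=
  ⨆ E : Finset S, |∑ x ∈ E, φ x - ∑ x ∈ E, ψ x|

/-- The mean reward `μ(s, a) = E[f(s, a, X)]`, where `X` has law `ν`. -/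
def meanReward {S A 𝒳 : Type*} [MeasurableSpace 𝒳] (f : S → A → 𝒳 → ℝ) (ν : Measure 𝒳)
    (s : S) (a : A) : ℝ :=
  ∫ x, f s a x ∂ν

/-- The table of sample means computed from the realizations `x 0, …, x (n - 1)`, by the recursive
update `θ ← (n θ + f(·, ·, x n)) / (n + 1)` started from `θ = 0`. -/
def sampleMean {S A 𝒳 : Type*} (f : S → A → 𝒳 → ℝ) (x : ℕ → 𝒳) : ℕ → S → A → ℝ
  | 0 => fun _ _ => 0
  | n + 1 => fun s a => ((n : ℝ) * sampleMean f x n s a + f s a (x n)) / ((n : ℝ) + 1)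

namespace FiniteMDP

variable {S A : Type*} [Fintype S] (M : FiniteMDP S A)

/-- A deterministic stationary policy: a choice of an allowed action in every state. -/
abbrev Policy : Type _ := ∀ s : S, M.allowed s

/-- The transition matrix of the Markov chain of states under the policy `β`. -/
def chain (β : M.Policy) : Matrix S S ℝ := fun s s' => M.trans s (β s) s'

/-- An MDP is ergodic if every deterministic stationary policy leads to an irreducible and
aperiodic Markov chain. -/
def IsErgodic [DecidableEq S] : Prop :=
  ∀ β : M.Policy, (M.chain β).IsIrreducible ∧ IsAperiodicChain (M.chain β)

/-- The average expected reward per slot `ρ(β, m) = ∑ₛ π_β(s) m(s, β(s))` of the policy `β` for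
the reward table `m`. -/
def avgReward (β : M.Policy) (m : S → A → ℝ) : ℝ :=
  ∑ s, stationaryDist (M.chain β) s * m s (β s)

/-- The optimal mean reward `ρ* = max_β ρ(β, m)`. -/
def optReward (m : S → A → ℝ) : ℝ := ⨆ β : M.Policy, M.avgReward β m

/-- `βopt` is the unique optimal deterministic stationary policy. -/
def IsUniqueOptimal (m : S → A → ℝ) (βopt : M.Policy) : Prop :=
  ∀ β : M.Policy, β ≠ βopt → M.avgReward β m < M.avgReward βopt m

/-- The gap `Δ₁ = ρ* - max_{β ≠ β*} ρ(β, m)`. -/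
def gap (m : S → A → ℝ) (βopt : M.Policy) : ℝ :=
  M.optReward m - ⨆ β : {β : M.Policy // β ≠ βopt}, M.avgReward β.1 m

/-- The maximum of a table over the allowed state-action pairs. -/
def maxPair (m : S → A → ℝ) : ℝ := ⨆ s : S, ⨆ a : M.allowed s, m s a

/-- The minimum of a table over the allowed state-action pairs. -/
def minPair (m : S → A → ℝ) : ℝ := ⨅ s : S, ⨅ a : M.allowed s, m s a

/-- `Δ_max = ρ* - min m(s, a)`. -/
def maxSlotRegret (m : S → A → ℝ) : ℝ := M.optReward m - M.minPair m

/-- `γ = max_{s, s'} ‖P_β(s', ·) - P_β(s, ·)‖_TV`. -/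
def tvCoeff (β : M.Policy) : ℝ := ⨆ s : S, ⨆ s' : S, tvDistance (M.chain β s') (M.chain β s)

/-- Feasibility for the average-reward linear program. -/
structure LPFeasible (π : S → A → ℝ) : Prop where
  nonneg : ∀ s, ∀ a ∈ M.allowed s, 0 ≤ π s a
  total : ∑ s, ∑ a ∈ M.allowed s, π s a = 1
  balance : ∀ s', ∑ a ∈ M.allowed s', π s' a =
    ∑ s, ∑ a ∈ M.allowed s, π s a * M.trans s a s'

/-- The objective of the linear program for the reward table `m`. -/
def lpObjective (m π : S → A → ℝ) : ℝ := ∑ s, ∑ a ∈ M.allowed s, π s a * m s a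

/-- `π` is an optimal solution of the linear program for the reward table `m`. -/
def IsLPSolution (m π : S → A → ℝ) : Prop :=
  M.LPFeasible π ∧ ∀ π', M.LPFeasible π' → M.lpObjective m π' ≤ M.lpObjective m π

/-- The policy `β` is read off from `π`: `β(s) ∈ argmax_{a ∈ A_s} π(s, a)` for every `s`. -/
def IsArgmaxPolicy (π : S → A → ℝ) (β : M.Policy) : Prop :=
  ∀ s, ∀ a ∈ M.allowed s, π s a ≤ π s (β s)

/-- The stochastic process obtained when LPSM is run on the MDP `M` with rewards
`r_t = f(s_t, a_t, X_t)` and `X_t` of law `ν`.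

`ℱ t` is the information available when the action of slot `t` has been chosen: it contains
`X_k` for `k < t` and the states, policies and actions up to slot `t`, and possibly the internal
randomness of the LP solver, of its tie-breaking and of the first action. -/
structure IsLPSMRun {𝒳 Ω : Type*} [MeasurableSpace 𝒳] [mΩ : MeasurableSpace Ω]
    (f : S → A → 𝒳 → ℝ) (ν : Measure 𝒳) (Pr : Measure Ω) (ℱ : Filtration ℕ mΩ)
    (X : ℕ → Ω → 𝒳) (state : ℕ → Ω → S) (action : ℕ → Ω → A) (β : ℕ → Ω → M.Policy) :
    Prop where
  X_measurable : ∀ t, Measurable[ℱ (t + 1)] (X t)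
  state_measurable : ∀ t, Measurable[ℱ t, ⊤] (state t)
  action_measurable : ∀ t, Measurable[ℱ t, ⊤] (action t)
  policy_measurable : ∀ t, Measurable[ℱ t, ⊤] (β t)
  /-- the `X_t` are i.i.d. with law `ν`, and `X_t` is independent of the past up to the choice of
  the action in slot `t` -/
  X_law : ∀ t, Pr.map (X t) = ν
  X_indep : ∀ t, Indep (MeasurableSpace.comap (X t) inferInstance) (ℱ t) Pr
  /-- given the past, the next state has law `P(· | s_t, a_t)` -/
  transition : ∀ t s', Pr[Set.indicator {ω | state (t + 1) ω = s'} (fun _ => (1 : ℝ)) | ℱ t]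
    =ᵐ[Pr] fun ω => M.trans (state t ω) (action t ω) s'
  /-- in slot `0` any allowed action is chosen -/
  action_zero : ∀ ω, action 0 ω ∈ M.allowed (state 0 ω)
  /-- in slot `n ≥ 1` the LP is solved with the current sample means in place of the mean rewards,
  and a policy is read off from the solution -/
  policy_lp : ∀ n, 1 ≤ n → ∀ ω, ∃ π : S → A → ℝ,
    M.IsLPSolution (sampleMean f (fun k => X k ω) n) π ∧ M.IsArgmaxPolicy π (β n ω)
  /-- in slot `n ≥ 1` that policy is followed -/
  action_succ : ∀ n, 1 ≤ n → ∀ ω, action n ω = β n ω (state n ω)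

/-- The cumulative regret `T ρ* - E[∑_{t < T} r_t]` after `T` slots, with `r_t = f(s_t, a_t, X_t)`
and `ρ*` the optimal mean reward. -/
def regret {𝒳 Ω : Type*} [MeasurableSpace 𝒳] [MeasurableSpace Ω]
    (f : S → A → 𝒳 → ℝ) (ν : Measure 𝒳) (Pr : Measure Ω)
    (X : ℕ → Ω → 𝒳) (state : ℕ → Ω → S) (action : ℕ → Ω → A) (T : ℕ) : ℝ :=
  (T : ℝ) * M.optReward (meanReward f ν) -
    ∫ ω, ∑ t ∈ Finset.range T, f (state t ω) (action t ω) (X t ω) ∂Pr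

end FiniteMDP

end

/-! The regret is bounded by counting the slots in which LPSM does not use `βopt`. Since `γ < 1`,
the chain of `βopt` has a bias function `h` solving the Poisson equation `h + ρ* = r + Q h`
(`exists_poisson`), where `r s` is the mean reward of `βopt` in `s`. Its oscillation is at most
`μ_max / (1 - γ)` (`oscillation_le_div`). In a slot where `βopt` is used, the expected loss is
exactly the expected increase of `h`; any other slot exceeds that increase by at most `μ_max / (1 -
γ) + Δ_max` (`slot_regret_le`). The increases telescope, and their total together with slot `0`
costs one more such constant (`sum_regret_le`).

It remains to sum the probabilities that the policy is wrong. A policy read off from an LP solution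
is optimal for the sample means (`IsLPSolution.avgReward_le`). If it differs from `βopt`, some
sample mean is off by at least half the gap (`exists_deviation`). Hoeffding's inequality and a union
bound make this geometrically unlikely in the number of slots (`measureReal_policy_ne_le`), and a
geometric series finishes the proof. -/

/-- In an irreducible chain, a set of states closed under transitions is empty or everything. -/
theorem Matrix.IsIrreducible.mem_of_closed {S : Type*} {Q : Matrix S S ℝ} (hQ : Q.IsIrreducible) {U : Set S}
    (hU : ∀ s ∈ U, ∀ s', 0 < Q s s' → s' ∈ U) {s : S} (hs : s ∈ U) (s' : S) : s' ∈ U := by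
  let : Quiver S := Q.toQuiver
  obtain ⟨p, -⟩ := hQ.connected s s'
  induction p with
  | nil => exact hs
  | cons p e ih => exact hU _ ih _ e.down

/-! ### Finite Markov chains: stationary distributions, total variation, Poisson equation. -/

section Chain

variable {S : Type*} [Fintype S]

/-- A stochastic matrix on a finite nonempty set has a stationary distribution. -/
theorem exists_isStationaryDist [DecidableEq S] [Nonempty S] (Q : Matrix S S ℝ)
    (hQ : ∀ s s', 0 ≤ Q s s') (hsum : ∀ s, ∑ s', Q s s' = 1) : ∃ π, IsStationaryDist Q π := by
  have hdet : (Q - 1).det = 0 := by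
    rw [← Matrix.exists_mulVec_eq_zero_iff]
    -- Rows sum to one, so constants are a right null vector of `Q - 1`; singularity then yields a
    -- left one.
    refine ⟨fun _ => 1, fun h => one_ne_zero (congrFun h (Classical.arbitrary S)), ?_⟩
    ext s
    simp [Matrix.mulVec, dotProduct, Matrix.one_apply, hsum]
  obtain ⟨v, hv0, hv⟩ := Matrix.exists_vecMul_eq_zero_iff.2 hdet
  have hvQ : ∀ s', v s' = ∑ s, v s * Q s s' := by
    intro s'
    have := congrFun hv s'
    simp only [Matrix.vecMul, dotProduct, Matrix.sub_apply, Matrix.one_apply, mul_sub, mul_ite,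
      mul_one, mul_zero, Finset.sum_sub_distrib, Finset.sum_ite_eq', Finset.mem_univ, if_true,
      Pi.zero_apply] at this
    linarith
  have hle : ∀ s' ∈ Finset.univ, |v s'| ≤ ∑ s, |v s| * Q s s' := by
    intro s' _
    conv_lhs => rw [hvQ s']
    refine (Finset.abs_sum_le_sum_abs _ _).trans_eq (Finset.sum_congr rfl fun s _ => ?_)
    rw [abs_mul, abs_of_nonneg (hQ s s')]
  -- `|v| ≤ |v| Q` entrywise with equal totals forces equality in every entry, so `|v|` is
  -- invariant.
  have heq : ∑ s', |v s'| = ∑ s', ∑ s, |v s| * Q s s' := by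
    rw [Finset.sum_comm]
    simp [← Finset.mul_sum, hsum]
  have hinv := (Finset.sum_eq_sum_iff_of_le hle).1 heq
  have hpos : 0 < ∑ s, |v s| := by
    obtain ⟨s, hs⟩ := Function.ne_iff.1 hv0
    exact Finset.sum_pos' (fun _ _ => abs_nonneg _) ⟨s, Finset.mem_univ s, abs_pos.2 hs⟩
  refine ⟨fun s => |v s| / ∑ s, |v s|, fun s => by positivity, ?_, fun s' => ?_⟩
  · rw [← Finset.sum_div, div_self hpos.ne']
  · beta_reduce
    rw [hinv s' (Finset.mem_univ s'), Finset.sum_div]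
    exact Finset.sum_congr rfl fun s _ => by ring

/-- Existence is all that is needed: the later arguments hold for whichever stationary distribution
was chosen. -/
theorem stationaryDist_spec {Q : Matrix S S ℝ} (h : ∃ π, IsStationaryDist Q π) :
    IsStationaryDist Q (stationaryDist Q) := by
  rw [stationaryDist, dif_pos h]
  exact h.choose_spec

/-- The expectations of `h` under two distributions differ by at most their total variation
distance times the oscillation of `h`. -/
theorem sum_mul_sub_sum_mul_le_tvDistance [Nonempty S] {φ ψ h : S → ℝ} (hφψ : ∑ s, φ s = ∑ s, ψ s) {c : ℝ}
    (hc : ∀ s s', h s - h s' ≤ c) :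
    ∑ s, φ s * h s - ∑ s, ψ s * h s ≤ tvDistance φ ψ * c := by
  classical
  obtain ⟨m, hm⟩ := Finite.exists_min h
  have hc0 : 0 ≤ c := by simpa using hc m m
  set E : Finset S := Finset.univ.filter fun s => ψ s ≤ φ s
  have htv : ∑ x ∈ E, φ x - ∑ x ∈ E, ψ x ≤ tvDistance φ ψ :=
    (le_abs_self _).trans
      (le_ciSup (f := fun E : Finset S => |∑ x ∈ E, φ x - ∑ x ∈ E, ψ x|)
        (Set.finite_range _).bddAbove E)
  -- Equal total mass allows subtracting the minimum of `h`, after which the states with `φ s < ψ s`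
  -- contribute nothing positive.
  calc ∑ s, φ s * h s - ∑ s, ψ s * h s
      = ∑ s, (φ s - ψ s) * (h s - h m) := by
        simp only [mul_sub, sub_mul, Finset.sum_sub_distrib, ← Finset.sum_mul, hφψ]
        ring
    _ ≤ ∑ s, if ψ s ≤ φ s then (φ s - ψ s) * c else 0 := by
        refine Finset.sum_le_sum fun s _ => ?_
        split_ifs with hs
        · exact mul_le_mul_of_nonneg_left (hc s m) (sub_nonneg.2 hs)
        · exact mul_nonpos_of_nonpos_of_nonneg (by linarith) (sub_nonneg.2 (hm s))
    _ = (∑ x ∈ E, φ x - ∑ x ∈ E, ψ x) * c := by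
        rw [← Finset.sum_filter, ← Finset.sum_sub_distrib, Finset.sum_mul]
    _ ≤ tvDistance φ ψ * c := mul_le_mul_of_nonneg_right htv hc0

/-- If `h = r + Q h` up to a constant and `Q` contracts oscillations by the factor `γ < 1`, then
the oscillation of `h` is at most that of `r` divided by `1 - γ`. -/
theorem oscillation_le_div {Q : Matrix S S ℝ} (hsum : ∀ s, ∑ s', Q s s' = 1) {γ : ℝ} (hγ : γ < 1)
    (htv : ∀ s s', tvDistance (Q s) (Q s') ≤ γ) {h r : S → ℝ} {ρ R : ℝ}
    (hh : ∀ s, h s + ρ = r s + ∑ s', Q s s' * h s') (hr : ∀ s s', r s - r s' ≤ R) (s s' : S) :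
    h s - h s' ≤ R / (1 - γ) := by
  have : Nonempty S := ⟨s⟩
  obtain ⟨m, hm⟩ := Finite.exists_min h
  obtain ⟨M, hM⟩ := Finite.exists_max h
  have hc : ∀ s s', h s - h s' ≤ h M - h m := fun s s' => sub_le_sub (hM s) (hm s')
  have h1 := sum_mul_sub_sum_mul_le_tvDistance (φ := Q M) (ψ := Q m) (by rw [hsum, hsum]) hc
  have h2 := mul_le_mul_of_nonneg_right (htv M m) (sub_nonneg.2 (hM m))
  refine (hc s s').trans ?_
  -- Subtracting the equation at the minimizer from the one at the maximizer gives `osc h ≤ R + γ *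
  -- osc h`.
  rw [le_div_iff₀ (by linarith)]
  linarith [hh M, hh m, hr M m]

/-- The Poisson equation of a chain that contracts oscillations. -/
theorem exists_poisson [DecidableEq S] {Q : Matrix S S ℝ} (hsum : ∀ s, ∑ s', Q s s' = 1) {γ : ℝ}
    (hγ : γ < 1) (htv : ∀ s s', tvDistance (Q s) (Q s') ≤ γ) {π : S → ℝ}
    (hπ : IsStationaryDist Q π) (r : S → ℝ) :
    ∃ h : S → ℝ, ∀ s, h s + ∑ s', π s' * r s' = r s + ∑ s', Q s s' * h s' := by
  obtain ⟨-, hπ1, hπQ⟩ := hπ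
  -- The rank-one term makes `1 - Q` invertible: pairing `L h = 0` with `π` gives `π h = 0`, hence
  -- `h = Q h`; contraction makes `h` constant, and that constant is zero.
  set L : Matrix S S ℝ := 1 - Q + Matrix.of fun _ s' => π s' with hL
  have hLapp : ∀ (h : S → ℝ) s, L.mulVec h s = h s - ∑ s', Q s s' * h s' + ∑ s', π s' * h s' := by
    intro h s
    simp [hL, Matrix.mulVec, dotProduct, Matrix.one_apply, add_mul, sub_mul,
      Finset.sum_add_distrib, Finset.sum_sub_distrib]
  have hπL : ∀ h : S → ℝ, ∑ s, π s * L.mulVec h s = ∑ s', π s' * h s' := by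
    intro h
    have h1 : ∑ s, π s * ∑ s', Q s s' * h s' = ∑ s', π s' * h s' := by
      simp only [Finset.mul_sum]
      rw [Finset.sum_comm]
      refine Finset.sum_congr rfl fun s' _ => ?_
      conv_rhs => rw [hπQ s', Finset.sum_mul]
      exact Finset.sum_congr rfl fun s _ => by ring
    simp only [hLapp, mul_add, mul_sub, Finset.sum_add_distrib, Finset.sum_sub_distrib, h1,
      ← Finset.sum_mul, hπ1]
    ring
  have hinj : Function.Injective L.mulVecLin := by
    rw [← LinearMap.ker_eq_bot, LinearMap.ker_eq_bot']
    intro h hh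
    rw [Matrix.mulVecLin_apply] at hh
    have hπh : ∑ s', π s' * h s' = 0 := by rw [← hπL h, hh]; simp
    have heq : ∀ s, h s + 0 = (fun _ => 0) s + ∑ s', Q s s' * h s' := by
      intro s
      have := congrFun hh s
      rw [hLapp, hπh, Pi.zero_apply] at this
      simp only
      linarith
    have hosc := oscillation_le_div hsum hγ htv heq (R := 0) (by simp)
    ext s
    have hconst : ∀ s', h s' = h s := fun s' => by
      have h1 := hosc s s'
      have h2 := hosc s' s
      rw [zero_div] at h1 h2
      linarith
    simp only [hconst, ← Finset.sum_mul, hπ1, one_mul] at hπh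
    simpa using hπh
  obtain ⟨h, hh⟩ := LinearMap.injective_iff_surjective.1 hinj r
  rw [Matrix.mulVecLin_apply] at hh
  refine ⟨h, fun s => ?_⟩
  -- Pairing `L h = r` with `π` shows that the rank-one term equals the average of `r`.
  have h1 := hπL h
  rw [hh] at h1
  have h2 := congrFun hh s
  rw [hLapp, ← h1] at h2
  linarith

end Chain

/-! ### Policies, their gap, and the linear program. -/

namespace FiniteMDP

variable {S A : Type*} [Fintype S] {M : FiniteMDP S A}

theorem chain_nonneg (β : M.Policy) (s s' : S) : 0 ≤ M.chain β s s' :=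
  M.trans_nonneg s _ (β s).2 s'

theorem chain_sum (β : M.Policy) (s : S) : ∑ s', M.chain β s s' = 1 :=
  M.trans_sum s _ (β s).2

theorem isStationaryDist_chain [DecidableEq S] [Nonempty S] (β : M.Policy) :
    IsStationaryDist (M.chain β) (stationaryDist (M.chain β)) :=
  stationaryDist_spec (exists_isStationaryDist _ (chain_nonneg β) (chain_sum β))

theorem le_maxPair (m : S → A → ℝ) {s : S} {a : A} (ha : a ∈ M.allowed s) : m s a ≤ M.maxPair m :=
  (le_ciSup (f := fun a : M.allowed s => m s a) (Set.finite_range _).bddAbove ⟨a, ha⟩).trans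
    (le_ciSup (f := fun s => ⨆ a : M.allowed s, m s a) (Set.finite_range _).bddAbove s)

theorem minPair_le (m : S → A → ℝ) {s : S} {a : A} (ha : a ∈ M.allowed s) : M.minPair m ≤ m s a :=
  (ciInf_le (f := fun s => ⨅ a : M.allowed s, m s a) (Set.finite_range _).bddBelow s).trans
    (ciInf_le (f := fun a : M.allowed s => m s a) (Set.finite_range _).bddBelow ⟨a, ha⟩)

theorem tvDistance_le_tvCoeff (β : M.Policy) (s s' : S) :
    tvDistance (M.chain β s) (M.chain β s') ≤ M.tvCoeff β :=
  (le_ciSup (f := fun t => tvDistance (M.chain β t) (M.chain β s'))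
    (Set.finite_range _).bddAbove s).trans
    (le_ciSup (f := fun s' => ⨆ t : S, tvDistance (M.chain β t) (M.chain β s'))
      (Set.finite_range _).bddAbove s')

theorem optReward_eq {m : S → A → ℝ} {βopt : M.Policy} (hopt : M.IsUniqueOptimal m βopt) :
    M.optReward m = M.avgReward βopt m := by
  have : Nonempty M.Policy := ⟨βopt⟩
  refine le_antisymm (ciSup_le fun β => ?_)
    (le_ciSup (f := fun β => M.avgReward β m) (Set.finite_range _).bddAbove βopt)
  rcases eq_or_ne β βopt with rfl | h
  · exact le_rfl
  · exact (hopt β h).le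

theorem gap_le {m : S → A → ℝ} {βopt : M.Policy} (hopt : M.IsUniqueOptimal m βopt) {β : M.Policy}
    (hβ : β ≠ βopt) : M.gap m βopt ≤ M.avgReward βopt m - M.avgReward β m := by
  rw [gap, optReward_eq hopt]
  exact sub_le_sub_left (le_ciSup (f := fun β : {β : M.Policy // β ≠ βopt} => M.avgReward β.1 m)
    (Set.finite_range _).bddAbove ⟨β, hβ⟩) _

/-- The supremum runs over a finite nonempty set of policies, so it is attained by a strictly worse
one. This makes the exponential rate positive. -/
theorem gap_pos {m : S → A → ℝ} {βopt : M.Policy} (hopt : M.IsUniqueOptimal m βopt)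
    (hother : ∃ β : M.Policy, β ≠ βopt) : 0 < M.gap m βopt := by
  have : Nonempty {β : M.Policy // β ≠ βopt} := nonempty_subtype.2 hother
  obtain ⟨β, hβ⟩ := exists_eq_ciSup_of_finite
    (f := fun β : {β : M.Policy // β ≠ βopt} => M.avgReward β.1 m)
  rw [gap, optReward_eq hopt, ← hβ]
  exact sub_pos.2 (hopt _ β.2)

theorem sum_allowed_ite {β : M.Policy} (s : S) (g : A → ℝ) [DecidableEq A] :
    ∑ a ∈ M.allowed s, (if a = β s then g a else 0) = g (β s) := by
  rw [Finset.sum_ite_eq' (M.allowed s), if_pos (β s).2]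

open Classical in
/-- The feasible point of the linear program that belongs to a deterministic policy. -/
noncomputable def occupation (β : M.Policy) (s : S) (a : A) : ℝ :=
  if a = β s then stationaryDist (M.chain β) s else 0

theorem sum_occupation_mul (β : M.Policy) (s : S) (g : A → ℝ) :
    ∑ a ∈ M.allowed s, occupation β s a * g a = stationaryDist (M.chain β) s * g (β s) := by
  classical
  rw [← sum_allowed_ite s fun a => stationaryDist (M.chain β) s * g a]
  exact Finset.sum_congr rfl fun a _ => by rw [occupation, ite_mul, zero_mul]

theorem sum_occupation (β : M.Policy) (s : S) :
    ∑ a ∈ M.allowed s, occupation β s a = stationaryDist (M.chain β) s := by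
  simpa using sum_occupation_mul β s fun _ => 1

theorem lpObjective_occupation (β : M.Policy) (m : S → A → ℝ) :
    M.lpObjective m (occupation β) = M.avgReward β m :=
  Finset.sum_congr rfl fun s _ => sum_occupation_mul β s (m s)

theorem lpFeasible_occupation [DecidableEq S] [Nonempty S] (β : M.Policy) :
    M.LPFeasible (occupation β) := by
  obtain ⟨h0, h1, hQ⟩ := isStationaryDist_chain β
  refine ⟨fun s a _ => ?_, ?_, fun s' => ?_⟩
  · rw [occupation]
    split_ifs
    exacts [h0 s, le_rfl]
  · simpa only [sum_occupation] using h1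
  · rw [sum_occupation, hQ s']
    exact Finset.sum_congr rfl fun s _ => (sum_occupation_mul β s fun a => M.trans s a s').symm

/-- A policy read off from a feasible point of the linear program only uses pairs with a positive
weight, provided that its chain is irreducible. -/
theorem LPFeasible.pos_of_isArgmaxPolicy {π : S → A → ℝ} (hπ : M.LPFeasible π) {β : M.Policy}
    (hβ : M.IsArgmaxPolicy π β) (hirr : (M.chain β).IsIrreducible) (s : S) : 0 < π s (β s) := by
  have key : ∀ t, (∃ a ∈ M.allowed t, 0 < π t a) → 0 < π t (β t) := fun t ⟨a, ha, h⟩ =>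
    h.trans_le (hβ t a ha)
  obtain ⟨t, ht⟩ : ∃ t, 0 < π t (β t) := by
    obtain ⟨t, -, ht⟩ := Finset.exists_lt_of_sum_lt (s := Finset.univ) (f := fun _ : S => (0 : ℝ))
      (g := fun s => ∑ a ∈ M.allowed s, π s a) (by simp [hπ.total])
    obtain ⟨a, ha, h⟩ := Finset.exists_lt_of_sum_lt (s := M.allowed t) (f := fun _ => (0 : ℝ))
      (g := π t) (by simpa using ht)
    exact ⟨t, key t ⟨a, ha, h⟩⟩
  -- Positive mass propagates: if the chosen pair at `u` carries mass and leads to `u'`, the balance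
  -- equation puts mass on some action at `u'`, hence on the maximizing one.
  refine hirr.mem_of_closed (U := {t | 0 < π t (β t)}) (fun u hu u' huu' => key u' ?_) ht s
  have hterm : ∀ v, ∀ a ∈ M.allowed v, 0 ≤ π v a * M.trans v a u' := fun v a ha =>
    mul_nonneg (hπ.nonneg v a ha) (M.trans_nonneg v a ha u')
  have hpos : 0 < ∑ a ∈ M.allowed u', π u' a := by
    rw [hπ.balance u']
    exact Finset.sum_pos' (fun v _ => Finset.sum_nonneg (hterm v)) ⟨u, Finset.mem_univ u,
      Finset.sum_pos' (hterm u) ⟨β u, (β u).2, mul_pos hu huu'⟩⟩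
  obtain ⟨a, ha, h⟩ := Finset.exists_lt_of_sum_lt (s := M.allowed u') (f := fun _ => (0 : ℝ))
    (g := π u') (by simpa using hpos)
  exact ⟨a, ha, h⟩

/-- A policy read off from an optimal solution of the linear program is optimal. -/
theorem IsLPSolution.avgReward_le [DecidableEq S] [Nonempty S] {θ π : S → A → ℝ}
    (hπ : M.IsLPSolution θ π) {β : M.Policy} (hβ : M.IsArgmaxPolicy π β)
    (hirr : (M.chain β).IsIrreducible) (β' : M.Policy) :
    M.avgReward β' θ ≤ M.avgReward β θ := by
  rw [← lpObjective_occupation, ← lpObjective_occupation]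
  refine (hπ.2 _ (lpFeasible_occupation β')).trans ?_
  have hx := lpFeasible_occupation β
  obtain ⟨h0, h1, -⟩ := isStationaryDist_chain β
  have hpos := hπ.1.pos_of_isArgmaxPolicy hβ hirr
  obtain ⟨s₀, hs₀⟩ := Finite.exists_min fun s => π s (β s)
  -- With ties, `π` may mix several policies. But `ε` times the occupation measure of `β` fits below
  -- `π`, so `π` is a convex combination of that measure and a feasible `π'`; optimality of `π` then
  -- forces the measure of `β` to be optimal too.
  obtain ⟨ε, hε0, hε1, hεπ⟩ : ∃ ε : ℝ, 0 < ε ∧ ε < 1 ∧ ∀ s, ε ≤ π s (β s) :=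
    ⟨min (π s₀ (β s₀)) (1 / 2), lt_min (hpos s₀) (by norm_num),
      (min_le_right _ _).trans_lt (by norm_num), fun s => (min_le_left _ _).trans (hs₀ s)⟩
  have hε : 0 < 1 - ε := sub_pos.2 hε1
  set π' : S → A → ℝ := fun s a => (π s a - ε * occupation β s a) / (1 - ε) with hπ'
  have hlin : ∀ (s : S) (g : A → ℝ), ∑ a ∈ M.allowed s, π' s a * g a =
      (∑ a ∈ M.allowed s, π s a * g a - ε * ∑ a ∈ M.allowed s, occupation β s a * g a)
        / (1 - ε) := fun s g => by
    rw [Finset.mul_sum, ← Finset.sum_sub_distrib, Finset.sum_div]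
    exact Finset.sum_congr rfl fun a _ => by simp only [hπ']; ring
  have hlin' : ∀ g : S → A → ℝ, ∑ s, ∑ a ∈ M.allowed s, π' s a * g s a =
      (∑ s, ∑ a ∈ M.allowed s, π s a * g s a
        - ε * ∑ s, ∑ a ∈ M.allowed s, occupation β s a * g s a) / (1 - ε) := fun g => by
    simp only [hlin]
    rw [← Finset.sum_div, Finset.sum_sub_distrib, ← Finset.mul_sum]
  have hfeas : M.LPFeasible π' := by
    refine ⟨fun s a ha => div_nonneg ?_ hε.le, ?_, fun s' => ?_⟩
    · rw [occupation]
      split_ifs with h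
      · have hle : stationaryDist (M.chain β) s ≤ 1 :=
          (Finset.single_le_sum (fun t _ => h0 t) (Finset.mem_univ s)).trans_eq h1
        have := mul_le_of_le_one_right hε0.le hle
        rw [h]
        linarith [hεπ s]
      · simpa using hπ.1.nonneg s a ha
    · have := hlin' fun _ _ => 1
      simp only [mul_one, hπ.1.total, hx.total] at this
      rw [this, div_self hε.ne']
    · have := hlin s' fun _ => 1
      simp only [mul_one] at this
      rw [this, hlin' fun s a => M.trans s a s', hπ.1.balance, hx.balance]
  have hobj : M.lpObjective θ π' =
      (M.lpObjective θ π - ε * M.lpObjective θ (occupation β)) / (1 - ε) := hlin' θ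
  have hle := hπ.2 π' hfeas
  rw [hobj, div_le_iff₀ hε] at hle
  nlinarith

/-- If a suboptimal policy looks optimal for the table `θ`, then `θ` deviates from the true table
by at least half the gap. -/
theorem exists_deviation [DecidableEq S] [Nonempty S] {m θ : S → A → ℝ} {βopt β : M.Policy}
    (hopt : M.IsUniqueOptimal m βopt) (hβ : β ≠ βopt)
    (hθ : M.avgReward βopt θ ≤ M.avgReward β θ) :
    (∃ s, ∃ a ∈ M.allowed s, M.gap m βopt / 2 ≤ θ s a - m s a) ∨
      ∃ s, M.gap m βopt / 2 ≤ m s (βopt s) - θ s (βopt s) := by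
  by_contra! ⟨h1, h2⟩
  have hgap := gap_le hopt hβ
  have key : ∀ (π g : S → ℝ) (c : ℝ), (∀ s, 0 ≤ π s) → ∑ s, π s = 1 → (∀ s, g s < c) →
      ∑ s, π s * g s < c := by
    intro π g c hπ0 hπ1 hg
    obtain ⟨t, -, ht⟩ := Finset.exists_lt_of_sum_lt (s := Finset.univ)
      (f := fun _ : S => (0 : ℝ)) (g := π) (by simp [hπ1])
    calc ∑ s, π s * g s < ∑ s, π s * c :=
          Finset.sum_lt_sum (fun s _ => mul_le_mul_of_nonneg_left (hg s).le (hπ0 s))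
            ⟨t, Finset.mem_univ t, mul_lt_mul_of_pos_left (hg t) ht⟩
      _ = c := by rw [← Finset.sum_mul, hπ1, one_mul]
  obtain ⟨p0, p1, -⟩ := isStationaryDist_chain β
  obtain ⟨q0, q1, -⟩ := isStationaryDist_chain βopt
  -- Averaging keeps both errors strictly below half the gap: overestimates under `β`,
  -- underestimates under `βopt`. Their sum would have to reach the gap, because `β` looks at least
  -- as good as `βopt`.
  have k1 := key _ (fun s => θ s (β s) - m s (β s)) _ p0 p1 fun s => h1 s _ (β s).2
  have k2 := key _ (fun s => m s (βopt s) - θ s (βopt s)) _ q0 q1 h2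
  simp only [mul_sub, Finset.sum_sub_distrib] at k1 k2
  simp only [avgReward] at hθ hgap
  linarith

end FiniteMDP

/-! ### Concentration of the sample means. -/

section Concentration

open scoped NNReal

/-- Multiplying out by `n` avoids a division and covers `n = 0` as well. -/
theorem mul_sampleMean {S A 𝒳 : Type*} (f : S → A → 𝒳 → ℝ) (x : ℕ → 𝒳) (n : ℕ) (s : S) (a : A) :
    (n : ℝ) * sampleMean f x n s a = ∑ k ∈ Finset.range n, f s a (x k) := by
  induction n with
  | zero => simp
  | succ n ih =>
    rw [Finset.sum_range_succ, ← ih, sampleMean]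
    push_cast
    field_simp

variable {𝒳 Ω : Type*} [MeasurableSpace 𝒳] [mΩ : MeasurableSpace Ω]

/-- If `X t` is independent of the past up to time `t` for every `t`, sums of a sub-Gaussian
function of the `X t` are sub-Gaussian. -/
theorem hasSubgaussianMGF_sum_range {Pr : Measure Ω} [IsProbabilityMeasure Pr] {ν : Measure 𝒳}
    {ℱ : Filtration ℕ mΩ} {X : ℕ → Ω → 𝒳} (hX : ∀ t, Measurable[ℱ (t + 1)] (X t))
    (hlaw : ∀ t, Pr.map (X t) = ν)
    (hind : ∀ t, Indep (MeasurableSpace.comap (X t) inferInstance) (ℱ t) Pr)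
    {g : 𝒳 → ℝ} (hg : Measurable g) {c : ℝ≥0} (hc : HasSubgaussianMGF g c ν) (n : ℕ) :
    HasSubgaussianMGF (fun ω => ∑ k ∈ Finset.range n, g (X k ω)) (n * c) Pr := by
  induction n with
  | zero => simp
  | succ n ih =>
    have hgX : HasSubgaussianMGF (g ∘ X n) c Pr :=
      HasSubgaussianMGF.of_map ((hX n).mono (ℱ.le _) le_rfl).aemeasurable (by rwa [hlaw n])
    have hmeas : Measurable[ℱ n] fun ω => ∑ k ∈ Finset.range n, g (X k ω) :=
      Finset.measurable_sum _ fun k hk =>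
        hg.comp ((hX k).mono (ℱ.mono (Finset.mem_range.1 hk)) le_rfl)
    -- The partial sum only involves `X k` with `k < n`, so it is `ℱ n`-measurable and independent
    -- of `X n`.
    have hindep : IndepFun (fun ω => ∑ k ∈ Finset.range n, g (X k ω)) (g ∘ X n) Pr := by
      rw [IndepFun_iff_Indep]
      refine indep_of_indep_of_le_left (indep_of_indep_of_le_right (hind n).symm ?_) hmeas.comap_le
      rw [← MeasurableSpace.comap_comp]
      exact MeasurableSpace.comap_mono hg.comap_le
    simpa [Finset.sum_range_succ, add_mul] using ih.add_of_indepFun hgX hindep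

/-- Hoeffding's inequality for a function of the `X t` that ranges in an interval of length `b`. -/
theorem measureReal_sum_range_ge_le {Pr : Measure Ω} [IsProbabilityMeasure Pr] {ν : Measure 𝒳}
    [IsProbabilityMeasure ν]
    {ℱ : Filtration ℕ mΩ} {X : ℕ → Ω → 𝒳} (hX : ∀ t, Measurable[ℱ (t + 1)] (X t))
    (hlaw : ∀ t, Pr.map (X t) = ν)
    (hind : ∀ t, Indep (MeasurableSpace.comap (X t) inferInstance) (ℱ t) Pr)
    {g : 𝒳 → ℝ} (hg : Measurable g) {l b : ℝ} (hb : 0 < b)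
    (hbound : ∀ᵐ x ∂ν, g x ∈ Set.Icc l (l + b)) {ε : ℝ} (hε : 0 ≤ ε) {n : ℕ} (hn : 1 ≤ n) :
    Pr.real {ω | n * ε ≤ ∑ k ∈ Finset.range n, (g (X k ω) - ∫ x, g x ∂ν)} ≤
      Real.exp (-(2 * (ε / b) ^ 2)) ^ n := by
  have h := (hasSubgaussianMGF_sum_range hX hlaw hind (hg.sub_const _)
    (hasSubgaussianMGF_of_mem_Icc hg.aemeasurable hbound) n).measure_ge_le
    (ε := n * ε) (by positivity)
  refine h.trans_eq ?_
  -- The variance proxy is `n * (b / 2) ^ 2`, so the exponent is `-(n * ε) ^ 2 / (2 * n * (b / 2) ^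
  -- 2) = -2 * n * (ε / b) ^ 2`.
  rw [← Real.exp_nat_mul]
  congr 1
  have hn' : (n : ℝ) ≠ 0 := by positivity
  simp only [add_sub_cancel_left, NNReal.coe_mul, NNReal.coe_natCast, NNReal.coe_pow,
    NNReal.coe_div, coe_nnnorm, Real.norm_of_nonneg hb.le, NNReal.coe_ofNat]
  field_simp

end Concentration

/-! ### Probability of using a suboptimal policy. -/

namespace FiniteMDP

variable {S A 𝒳 Ω : Type*} [Fintype S] [DecidableEq S] [MeasurableSpace 𝒳]
  [mΩ : MeasurableSpace Ω] {M : FiniteMDP S A} {f : S → A → 𝒳 → ℝ} {ν : Measure 𝒳}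
  [IsProbabilityMeasure ν] {Pr : Measure Ω} [IsProbabilityMeasure Pr] {ℱ : Filtration ℕ mΩ}
  {X : ℕ → Ω → 𝒳} {state : ℕ → Ω → S} {action : ℕ → Ω → A} {β : ℕ → Ω → M.Policy}

omit [DecidableEq S] in
/-- The rewards of an allowed pair lie in an interval of length `maxPair B`. -/
theorem exists_forall_ae_mem_Icc {D : Set 𝒳} (hD : ∀ᵐ x ∂ν, x ∈ D) {B : S → A → ℝ}
    (hB : ∀ s, ∀ a ∈ M.allowed s, ∀ x ∈ D, ∀ y ∈ D, f s a x - f s a y ≤ B s a)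
    {s : S} {a : A} (ha : a ∈ M.allowed s) :
    ∃ l, ∀ᵐ x ∂ν, f s a x ∈ Set.Icc l (l + M.maxPair B) := by
  obtain ⟨x₀, hx₀⟩ := hD.exists
  have : Nonempty D := ⟨⟨x₀, hx₀⟩⟩
  have hle := le_maxPair (M := M) B ha
  have hbdd : BddBelow (Set.range fun y : D => f s a y) :=
    ⟨f s a x₀ - B s a, by rintro _ ⟨y, rfl⟩; linarith [hB s a ha x₀ hx₀ y y.2]⟩
  refine ⟨⨅ y : D, f s a y, hD.mono fun x hx => ⟨ciInf_le hbdd ⟨x, hx⟩, ?_⟩⟩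
  have : f s a x - M.maxPair B ≤ ⨅ y : D, f s a y :=
    le_ciInf fun y => by linarith [hB s a ha x hx y y.2]
  linarith

/-- The probability that LPSM does not find the optimal policy decays geometrically. -/
theorem IsLPSMRun.measureReal_policy_ne_le [Fintype A]
    (hrun : M.IsLPSMRun f ν Pr ℱ X state action β) (hM : M.IsErgodic)
    (hf : ∀ s, ∀ a ∈ M.allowed s, Measurable (f s a)) {D : Set 𝒳} (hD : ∀ᵐ x ∂ν, x ∈ D)
    {B : S → A → ℝ}
    (hB : ∀ s, ∀ a ∈ M.allowed s, ∀ x ∈ D, ∀ y ∈ D, f s a x - f s a y ≤ B s a)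
    (hB0 : 0 < M.maxPair B) {βopt : M.Policy}
    (hopt : M.IsUniqueOptimal (meanReward f ν) βopt) (hother : ∃ β : M.Policy, β ≠ βopt)
    {n : ℕ} (hn : 1 ≤ n) :
    Pr.real {ω | β n ω ≠ βopt} ≤ (1 + (Fintype.card A : ℝ)) * (Fintype.card S : ℝ) *
      Real.exp (-((1 / 2) * (M.gap (meanReward f ν) βopt / M.maxPair B) ^ 2)) ^ n := by
  have : Nonempty S := by
    obtain ⟨β', hβ'⟩ := hother
    obtain ⟨s, -⟩ := Function.ne_iff.1 hβ'
    exact ⟨s⟩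
  set G := M.gap (meanReward f ν) βopt with hG
  have hG0 : 0 < G := gap_pos hopt hother
  set q := Real.exp (-((1 / 2) * (G / M.maxPair B) ^ 2)) with hq
  -- The deviation is half the gap, which turns Hoeffding's factor `2` into `1 / 2`.
  have hqε : Real.exp (-(2 * (G / 2 / M.maxPair B) ^ 2)) = q := by
    rw [hq]; congr 1; ring
  have hn0 : (0 : ℝ) < n := by exact_mod_cast hn
  set θ : Ω → S → A → ℝ := fun ω => sampleMean f (fun k => X k ω) n
  have hup : ∀ s, ∀ a ∈ M.allowed s,
      Pr.real {ω | G / 2 ≤ θ ω s a - meanReward f ν s a} ≤ q ^ n := by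
    intro s a ha
    obtain ⟨l, hl⟩ := exists_forall_ae_mem_Icc hD hB ha
    rw [← hqε]
    refine (measureReal_mono fun ω hω => ?_).trans (measureReal_sum_range_ge_le
      hrun.X_measurable hrun.X_law hrun.X_indep (hf s a ha) hB0 hl (half_pos hG0).le hn)
    rw [Set.mem_ofPred_eq, Finset.sum_sub_distrib, Finset.sum_const, Finset.card_range,
      nsmul_eq_mul, ← mul_sampleMean f (fun k => X k ω), ← mul_sub]
    exact mul_le_mul_of_nonneg_left hω hn0.le
  have hdown : ∀ s, ∀ a ∈ M.allowed s,
      Pr.real {ω | G / 2 ≤ meanReward f ν s a - θ ω s a} ≤ q ^ n := by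
    intro s a ha
    obtain ⟨l, hl⟩ := exists_forall_ae_mem_Icc hD hB ha
    -- The lower tail is the upper tail of `-f`, whose range is the reflected interval.
    have hl' : ∀ᵐ x ∂ν, -f s a x ∈ Set.Icc (-(l + M.maxPair B))
        (-(l + M.maxPair B) + M.maxPair B) :=
      hl.mono fun x hx => ⟨neg_le_neg hx.2, by linarith [hx.1]⟩
    rw [← hqε]
    refine (measureReal_mono fun ω hω => ?_).trans (measureReal_sum_range_ge_le
      hrun.X_measurable hrun.X_law hrun.X_indep (hf s a ha).neg hB0 hl' (half_pos hG0).le hn)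
    rw [Set.mem_ofPred_eq, Finset.sum_sub_distrib, Finset.sum_const, Finset.card_range,
      nsmul_eq_mul]
    simp only [Pi.neg_apply]
    rw [Finset.sum_neg_distrib, ← mul_sampleMean f (fun k => X k ω), integral_neg]
    have := mul_le_mul_of_nonneg_left hω.out hn0.le
    simp only [meanReward] at this
    linarith
  -- Overestimates count for at most `S * A` pairs, underestimates only for the `S` pairs of `βopt`;
  -- this is the factor `(1 + A) * S`.
  have hsub : {ω | β n ω ≠ βopt} ⊆
      (⋃ s ∈ Finset.univ, ⋃ a ∈ M.allowed s, {ω | G / 2 ≤ θ ω s a - meanReward f ν s a}) ∪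
        ⋃ s ∈ Finset.univ, {ω | G / 2 ≤ meanReward f ν s (βopt s) - θ ω s (βopt s)} := by
    intro ω hω
    obtain ⟨π, hπ, hβ⟩ := hrun.policy_lp n hn ω
    simpa using exists_deviation hopt hω (hπ.avgReward_le hβ (hM _).1 βopt)
  calc Pr.real {ω | β n ω ≠ βopt}
      ≤ ∑ s : S, ∑ a ∈ M.allowed s, q ^ n + ∑ s : S, q ^ n :=
        (measureReal_mono hsub).trans <| (measureReal_union_le _ _).trans <| add_le_add
          ((measureReal_biUnion_finset_le _ _).trans <| Finset.sum_le_sum fun s _ =>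
            (measureReal_biUnion_finset_le _ _).trans <| Finset.sum_le_sum (hup s))
          ((measureReal_biUnion_finset_le _ _).trans <| Finset.sum_le_sum fun s _ =>
            hdown s _ (βopt s).2)
    _ ≤ ∑ s : S, Fintype.card A * q ^ n + ∑ s : S, q ^ n := by
        gcongr with s
        rw [Finset.sum_const, nsmul_eq_mul]
        gcongr
        exact Finset.card_le_univ _
    _ = (1 + (Fintype.card A : ℝ)) * (Fintype.card S : ℝ) * q ^ n := by
        simp only [Finset.sum_const, Finset.card_univ, nsmul_eq_mul]
        ring

end FiniteMDP

/-! ### Expected rewards and the regret decomposition along a run. -/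

namespace FiniteMDP

variable {S A 𝒳 Ω : Type*} [Fintype S] [MeasurableSpace 𝒳]
  [mΩ : MeasurableSpace Ω] {M : FiniteMDP S A} {f : S → A → 𝒳 → ℝ} {ν : Measure 𝒳}
  {Pr : Measure Ω} {ℱ : Filtration ℕ mΩ}
  {X : ℕ → Ω → 𝒳} {state : ℕ → Ω → S} {action : ℕ → Ω → A} {β : ℕ → Ω → M.Policy}

theorem IsLPSMRun.action_mem (hrun : M.IsLPSMRun f ν Pr ℱ X state action β) (t : ℕ) (ω : Ω) :
    action t ω ∈ M.allowed (state t ω) := by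
  rcases Nat.eq_zero_or_pos t with rfl | ht
  · exact hrun.action_zero ω
  · rw [hrun.action_succ t ht ω]
    exact (β t ω _).2

theorem IsLPSMRun.measurableSet_state_action (hrun : M.IsLPSMRun f ν Pr ℱ X state action β)
    (t : ℕ) (s : S) (a : A) : MeasurableSet[ℱ t] {ω | state t ω = s ∧ action t ω = a} :=
  (measurableSet_preimage (hrun.state_measurable t) (show MeasurableSet[⊤] {s} from trivial)).inter
    (measurableSet_preimage (hrun.action_measurable t) (show MeasurableSet[⊤] {a} from trivial))

/-- A function of the current state and action is a finite sum of indicators. -/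
theorem IsLPSMRun.apply_eq_sum_indicator (hrun : M.IsLPSMRun f ν Pr ℱ X state action β) (t : ℕ)
    (F : S → A → Ω → ℝ) : (fun ω => F (state t ω) (action t ω) ω) = fun ω =>
      ∑ s, ∑ a ∈ M.allowed s, {ω | state t ω = s ∧ action t ω = a}.indicator (F s a) ω := by
  classical
  ext ω
  rw [Finset.sum_eq_single (state t ω), Finset.sum_eq_single (action t ω)]
  · simp
  · exact fun a _ ha => Set.indicator_of_notMem (fun h => ha h.2.symm) _
  · exact fun h => absurd (hrun.action_mem t ω) h
  · exact fun s _ hs => Finset.sum_eq_zero fun a _ =>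
      Set.indicator_of_notMem (fun h => hs h.1.symm) _
  · simp

theorem IsLPSMRun.integrable_apply (hrun : M.IsLPSMRun f ν Pr ℱ X state action β) (t : ℕ)
    {F : S → A → Ω → ℝ} (hF : ∀ s, ∀ a ∈ M.allowed s, Integrable (F s a) Pr) :
    Integrable (fun ω => F (state t ω) (action t ω) ω) Pr := by
  rw [hrun.apply_eq_sum_indicator]
  exact integrable_finsetSum _ fun s _ => integrable_finsetSum _ fun a ha =>
    (hF s a ha).indicator (ℱ.le t _ (hrun.measurableSet_state_action t s a))

theorem IsLPSMRun.integral_apply (hrun : M.IsLPSMRun f ν Pr ℱ X state action β) (t : ℕ)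
    {F : S → A → Ω → ℝ} (hF : ∀ s, ∀ a ∈ M.allowed s, Integrable (F s a) Pr) :
    ∫ ω, F (state t ω) (action t ω) ω ∂Pr =
      ∑ s, ∑ a ∈ M.allowed s, ∫ ω in {ω | state t ω = s ∧ action t ω = a}, F s a ω ∂Pr := by
  have hm := fun s a => ℱ.le t _ (hrun.measurableSet_state_action t s a)
  have hi := fun s a ha => (hF s a ha).indicator (hm s a)
  rw [hrun.apply_eq_sum_indicator, integral_finsetSum _ fun s _ =>
    integrable_finsetSum _ (hi s)]
  refine Finset.sum_congr rfl fun s _ => ?_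
  rw [integral_finsetSum _ (hi s)]
  exact Finset.sum_congr rfl fun a _ => integral_indicator (hm s a)

theorem IsLPSMRun.integrable_reward (hrun : M.IsLPSMRun f ν Pr ℱ X state action β)
    (hf : ∀ s, ∀ a ∈ M.allowed s, Integrable (f s a) ν) (t : ℕ) (s : S) (a : A)
    (ha : a ∈ M.allowed s) : Integrable (fun ω => f s a (X t ω)) Pr :=
  (hrun.X_law t ▸ hf s a ha).comp_measurable ((hrun.X_measurable t).mono (ℱ.le _) le_rfl)

variable [IsProbabilityMeasure Pr]

/-- The expected reward of a slot is the expected mean reward of the pair chosen in it. -/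
theorem IsLPSMRun.integral_reward (hrun : M.IsLPSMRun f ν Pr ℱ X state action β)
    (hf : ∀ s, ∀ a ∈ M.allowed s, Measurable (f s a))
    (hfi : ∀ s, ∀ a ∈ M.allowed s, Integrable (f s a) ν) (t : ℕ) :
    ∫ ω, f (state t ω) (action t ω) (X t ω) ∂Pr =
      ∫ ω, meanReward f ν (state t ω) (action t ω) ∂Pr := by
  have hX : Measurable (X t) := (hrun.X_measurable t).mono (ℱ.le _) le_rfl
  rw [hrun.integral_apply t (F := fun s a ω => f s a (X t ω)) (hrun.integrable_reward hfi t),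
    hrun.integral_apply t (F := fun s a _ => meanReward f ν s a)
      fun _ _ _ => integrable_const _]
  refine Finset.sum_congr rfl fun s _ => Finset.sum_congr rfl fun a ha => ?_
  have hE := hrun.measurableSet_state_action t s a
  -- The event that fixes the current pair lies in `ℱ t`, of which `X t` is independent, so on it
  -- the reward may be replaced by its mean.
  have hc := condExp_indep_eq (f := fun ω => f s a (X t ω)) hX.comap_le (ℱ.le t)
    ((hf s a ha).comp (comap_measurable (X t))).stronglyMeasurable (hrun.X_indep t)
  have hmean : ∫ ω, f s a (X t ω) ∂Pr = meanReward f ν s a := by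
    rw [meanReward, ← hrun.X_law t, integral_map hX.aemeasurable
      (hf s a ha).aestronglyMeasurable]
  rw [← setIntegral_condExp (ℱ.le t) (hrun.integrable_reward hfi t s a ha) hE]
  refine setIntegral_congr_ae (ℱ.le t _ hE) (hc.mono fun ω hω _ => ?_)
  rw [hω, hmean]

/-- The expectation of a function of the next state. -/
theorem IsLPSMRun.integral_next_state (hrun : M.IsLPSMRun f ν Pr ℱ X state action β) (h : S → ℝ)
    (t : ℕ) : ∫ ω, h (state (t + 1) ω) ∂Pr =
      ∫ ω, ∑ s', M.trans (state t ω) (action t ω) s' * h s' ∂Pr := by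
  classical
  have hE : ∀ s', MeasurableSet {ω | state (t + 1) ω = s'} := fun s' =>
    ℱ.le _ _ <|
    measurableSet_preimage (hrun.state_measurable (t + 1)) (show MeasurableSet[⊤] {s'} from trivial)
  have hsum : ∀ ω, h (state (t + 1) ω) =
      ∑ s', Set.indicator {ω | state (t + 1) ω = s'} (fun _ => (1 : ℝ)) ω * h s' := fun ω => by
    simp [Set.indicator_apply]
  simp only [hsum]
  rw [integral_finsetSum _ fun s' _ => ((integrable_const _).indicator (hE s')).mul_const _,
    integral_finsetSum _ fun s' _ => (hrun.integrable_apply t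
      (F := fun s a _ => M.trans s a s') fun _ _ _ => integrable_const _).mul_const _]
  refine Finset.sum_congr rfl fun s' _ => ?_
  rw [integral_mul_const, integral_mul_const, ← integral_condExp (ℱ.le t),
    integral_congr_ae (hrun.transition t s')]

/-- In expectation, the loss of a slot is at most the increase of the bias function `h` of the
optimal policy, plus a constant times the probability that another policy is used. -/
theorem IsLPSMRun.slot_regret_le (hrun : M.IsLPSMRun f ν Pr ℱ X state action β)
    {m : S → A → ℝ} {βopt : M.Policy} {h : S → ℝ} {ρ c Δ : ℝ}
    (hh : ∀ s, h s + ρ = m s (βopt s) + ∑ s', M.chain βopt s s' * h s')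
    (hc : ∀ s s', h s - h s' ≤ c) (hΔ : ∀ s, ∀ a ∈ M.allowed s, ρ - m s a ≤ Δ)
    {t : ℕ} (ht : 1 ≤ t) :
    ρ - ∫ ω, m (state t ω) (action t ω) ∂Pr ≤
      ∫ ω, h (state (t + 1) ω) ∂Pr - ∫ ω, h (state t ω) ∂Pr
        + (c + Δ) * Pr.real {ω | β t ω ≠ βopt} := by
  have hG : MeasurableSet {ω | β t ω ≠ βopt} :=
    ℱ.le _ _ <|
    measurableSet_preimage (hrun.policy_measurable t) (show MeasurableSet[⊤] {βopt}ᶜ from trivial)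
  have hint : ∀ g : S → A → ℝ, Integrable (fun ω => g (state t ω) (action t ω)) Pr := fun g =>
    hrun.integrable_apply t (F := fun s a _ => g s a) fun _ _ _ => integrable_const _
  have i1 := hint m
  have i2 := hint fun s a => ∑ s', M.trans s a s' * h s'
  have i3 := hint fun s _ => h s
  have i4 : Integrable ({ω | β t ω ≠ βopt}.indicator fun _ => c + Δ) Pr :=
    (integrable_const _).indicator hG
  have i5 : Integrable (fun ω => ∑ s', M.trans (state t ω) (action t ω) s' * h s'
      - h (state t ω)) Pr := i2.sub i3
  rw [hrun.integral_next_state, mul_comm (c + Δ), ← smul_eq_mul (Pr.real _),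
    ← integral_indicator_const _ hG, ← integral_sub i2 i3]
  have hconst : ρ = ∫ _, ρ ∂Pr := by simp
  conv_lhs => rw [hconst]
  rw [← integral_sub (integrable_const _) i1, ← integral_add i5 i4]
  refine integral_mono ((integrable_const _).sub i1) (i5.add i4) fun ω => ?_
  have ha := hrun.action_mem t ω
  -- On this event the Poisson equation gives equality. Off it, the loss is at most `Δ`, and `h`
  -- drops by at most `c` in conditional mean.
  by_cases hω : β t ω = βopt
  · have h1 := hh (state t ω)
    have h2 : action t ω = βopt (state t ω) := by rw [hrun.action_succ t ht ω, hω]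
    simp only [chain] at h1
    simp only [Set.indicator_of_notMem (show ω ∉ {ω | β t ω ≠ βopt} from fun h' => h' hω), h2]
    linarith
  · simp only [Set.indicator_of_mem (show ω ∈ {ω | β t ω ≠ βopt} from hω)]
    have h1 := hΔ _ _ ha
    have h2 : h (state t ω) - c ≤ ∑ s', M.trans (state t ω) (action t ω) s' * h s' := by
      calc h (state t ω) - c
          = ∑ s', M.trans (state t ω) (action t ω) s' * (h (state t ω) - c) := by
            rw [← Finset.sum_mul, M.trans_sum _ _ ha, one_mul]
        _ ≤ _ := Finset.sum_le_sum fun s' _ => mul_le_mul_of_nonneg_left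
            (by linarith [hc (state t ω) s']) (M.trans_nonneg _ _ ha s')
    linarith

/-- The total loss is controlled by the probabilities that LPSM does not use the optimal policy;
slot `0` counts as such a slot. -/
theorem IsLPSMRun.sum_regret_le (hrun : M.IsLPSMRun f ν Pr ℱ X state action β)
    {m : S → A → ℝ} {βopt : M.Policy} {h : S → ℝ} {ρ c Δ : ℝ}
    (hh : ∀ s, h s + ρ = m s (βopt s) + ∑ s', M.chain βopt s s' * h s')
    (hc : ∀ s s', h s - h s' ≤ c) (hΔ : ∀ s, ∀ a ∈ M.allowed s, ρ - m s a ≤ Δ) (n : ℕ) :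
    ∑ t ∈ Finset.range (n + 1), (ρ - ∫ ω, m (state t ω) (action t ω) ∂Pr) ≤
      (1 + ∑ t ∈ Finset.range n, Pr.real {ω | β (t + 1) ω ≠ βopt}) * (c + Δ) := by
  have hint : ∀ t (g : S → A → ℝ), Integrable (fun ω => g (state t ω) (action t ω)) Pr :=
    fun t g => hrun.integrable_apply t (F := fun s a _ => g s a) fun _ _ _ => integrable_const _
  have h0 : ρ - ∫ ω, m (state 0 ω) (action 0 ω) ∂Pr ≤ Δ := by
    have := integral_mono (integrable_const (ρ - Δ)) (hint 0 m) fun ω => by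
      linarith [hΔ _ _ (hrun.action_mem 0 ω)]
    rw [integral_const, probReal_univ, one_smul] at this
    linarith
  have hend : ∫ ω, h (state (n + 1) ω) ∂Pr - ∫ ω, h (state (0 + 1) ω) ∂Pr ≤ c := by
    have j1 := hint (n + 1) fun s _ => h s
    have j2 := hint (0 + 1) fun s _ => h s
    rw [← integral_sub j1 j2]
    refine (integral_mono (j1.sub j2) (integrable_const c) fun ω => hc _ _).trans_eq ?_
    simp
  have hsum := Finset.sum_le_sum fun t (_ : t ∈ Finset.range n) =>
    hrun.slot_regret_le hh hc hΔ (Nat.le_add_left 1 t)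
  rw [Finset.sum_add_distrib, Finset.sum_range_sub (fun t => ∫ ω, h (state (t + 1) ω) ∂Pr),
    ← Finset.mul_sum] at hsum
  -- Slot `0` is split off because its action need not follow a policy; its cost `Δ` and the
  -- telescoped `c` form the leading `1` of the bound.
  rw [Finset.sum_range_succ']
  linarith

omit [MeasurableSpace 𝒳] in
theorem maxSlotRegret_nonneg [DecidableEq S] [Nonempty S] {m : S → A → ℝ} {βopt : M.Policy}
    (hopt : M.IsUniqueOptimal m βopt) : 0 ≤ M.maxSlotRegret m := by
  obtain ⟨h0, h1, -⟩ := isStationaryDist_chain βopt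
  rw [maxSlotRegret, optReward_eq hopt, sub_nonneg]
  calc M.minPair m = ∑ s, stationaryDist (M.chain βopt) s * M.minPair m := by
        rw [← Finset.sum_mul, h1, one_mul]
    _ ≤ _ := Finset.sum_le_sum fun s _ =>
        mul_le_mul_of_nonneg_left (minPair_le m (βopt s).2) (h0 s)

end FiniteMDP

/-! ### Geometric series and conclusion. -/

/-- With `q = exp (-x)`, the series starts at exponent `1`, so its sum is at most `q / (1 - q) = 1 /
(exp x - 1)`. -/
theorem sum_range_exp_neg_pow_le {x : ℝ} (hx : 0 < x) (n : ℕ) :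
    ∑ t ∈ Finset.range n, Real.exp (-x) ^ (t + 1) ≤ 1 / (Real.exp x - 1) := by
  have hq : Real.exp (-x) < 1 := Real.exp_lt_one_iff.2 (neg_lt_zero.2 hx)
  have hp : 0 < Real.exp x - 1 := sub_pos.2 (Real.one_lt_exp_iff.2 hx)
  have h1 : Real.exp (-x) * Real.exp x = 1 := by rw [← Real.exp_add]; simp
  have hgeom := geom_sum_mul (Real.exp (-x)) n
  have hpow : 0 ≤ Real.exp (-x) ^ n := by positivity
  simp only [pow_succ]
  rw [← Finset.sum_mul, le_div_iff₀ hp, mul_assoc, mul_sub, h1, mul_one,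
    ← neg_sub (Real.exp (-x)) 1, mul_neg, hgeom]
  linarith

theorem mainTheorem1 {S A 𝒳 Ω : Type*} [Fintype S] [DecidableEq S] [Fintype A]
    [MeasurableSpace 𝒳] [mΩ : MeasurableSpace Ω]
    -- an ergodic MDP
    (M : FiniteMDP S A) (hM : M.IsErgodic)
    -- the reward function and the law of the internal random variable, with support in `D`
    (f : S → A → 𝒳 → ℝ) (hf : ∀ s, ∀ a ∈ M.allowed s, Measurable (f s a))
    (ν : Measure 𝒳) [IsProbabilityMeasure ν] (D : Set 𝒳) (hD : ∀ᵐ x ∂ν, x ∈ D)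
    -- `B s a` bounds the range of the reward over the support
    (B : S → A → ℝ)
    (hB : ∀ s, ∀ a ∈ M.allowed s, ∀ x ∈ D, ∀ y ∈ D, f s a x - f s a y ≤ B s a)
    (hB0 : 0 < M.maxPair B)
    -- mean rewards are nonnegative
    (hnonneg : ∀ s, ∀ a ∈ M.allowed s, 0 ≤ meanReward f ν s a)
    -- the optimal policy is unique, there are other policies, and `γ < 1`
    (βopt : M.Policy) (hopt : M.IsUniqueOptimal (meanReward f ν) βopt)
    (hother : ∃ β : M.Policy, β ≠ βopt)
    (hγ : M.tvCoeff βopt < 1)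
    -- a run of LPSM
    (Pr : Measure Ω) [IsProbabilityMeasure Pr] (ℱ : Filtration ℕ mΩ)
    (X : ℕ → Ω → 𝒳) (state : ℕ → Ω → S) (action : ℕ → Ω → A) (β : ℕ → Ω → M.Policy)
    (hrun : M.IsLPSMRun f ν Pr ℱ X state action β) (T : ℕ) :
    M.regret f ν Pr X state action T ≤
      (1 + (1 + (Fintype.card A : ℝ)) * (Fintype.card S : ℝ) /
          (Real.exp ((1 / 2) * (M.gap (meanReward f ν) βopt / M.maxPair B) ^ 2) - 1)) *
        (M.maxPair (meanReward f ν) / (1 - M.tvCoeff βopt) +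
          M.maxSlotRegret (meanReward f ν)) := by
  have : Nonempty S := by
    obtain ⟨β', hβ'⟩ := hother
    obtain ⟨s, -⟩ := Function.ne_iff.1 hβ'
    exact ⟨s⟩
  set m := meanReward f ν with hm
  have hfi : ∀ s, ∀ a ∈ M.allowed s, Integrable (f s a) ν := fun s a ha => by
    obtain ⟨l, hl⟩ := FiniteMDP.exists_forall_ae_mem_Icc hD hB ha
    exact Integrable.of_mem_Icc _ _ (hf s a ha).aemeasurable hl
  have htv : ∀ s s', tvDistance (M.chain βopt s) (M.chain βopt s') ≤ M.tvCoeff βopt :=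
    FiniteMDP.tvDistance_le_tvCoeff βopt
  have hsum := FiniteMDP.chain_sum βopt
  obtain ⟨h, hh⟩ := exists_poisson hsum hγ htv (FiniteMDP.isStationaryDist_chain βopt)
    fun s => m s (βopt s)
  -- As mean rewards are nonnegative, their differences are at most the maximal mean reward.
  have hosc := oscillation_le_div hsum hγ htv hh (R := M.maxPair m) fun s s' => by
    linarith [FiniteMDP.le_maxPair m (βopt s).2, hnonneg s' _ (βopt s').2]
  have hΔ : ∀ s, ∀ a ∈ M.allowed s, M.avgReward βopt m - m s a ≤ M.maxSlotRegret m :=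
    fun s a ha => by
      rw [FiniteMDP.maxSlotRegret, FiniteMDP.optReward_eq hopt]
      linarith [FiniteMDP.minPair_le m ha]
  have hcΔ : 0 ≤ M.maxPair m / (1 - M.tvCoeff βopt) + M.maxSlotRegret m := by
    have s := Classical.arbitrary S
    exact add_nonneg (by simpa using hosc s s) (FiniteMDP.maxSlotRegret_nonneg hopt)
  set x := (1 / 2) * (M.gap m βopt / M.maxPair B) ^ 2 with hx
  have hx0 : 0 < x := by
    have := FiniteMDP.gap_pos hopt hother
    positivity
  have hreg : M.regret f ν Pr X state action T = ∑ t ∈ Finset.range T,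
      (M.avgReward βopt m - ∫ ω, m (state t ω) (action t ω) ∂Pr) := by
    rw [FiniteMDP.regret, FiniteMDP.optReward_eq hopt, integral_finsetSum _ fun t _ =>
      hrun.integrable_apply t (F := fun s a ω => f s a (X t ω)) (hrun.integrable_reward hfi t),
      Finset.sum_sub_distrib, Finset.sum_const, Finset.card_range, nsmul_eq_mul]
    congr 1
    exact Finset.sum_congr rfl fun t _ => hrun.integral_reward hf hfi t
  rw [hreg]
  -- The decomposition charges for slot `0`, so the empty horizon is treated apart.
  cases T with
  | zero =>
    have := sub_pos.2 (Real.one_lt_exp_iff.2 hx0)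
    rw [Finset.sum_range_zero]
    positivity
  | succ n =>
    refine (hrun.sum_regret_le hh hosc hΔ n).trans (mul_le_mul_of_nonneg_right ?_ hcΔ)
    refine add_le_add_right ?_ 1
    calc ∑ t ∈ Finset.range n, Pr.real {ω | β (t + 1) ω ≠ βopt}
        ≤ ∑ t ∈ Finset.range n, (1 + (Fintype.card A : ℝ)) * (Fintype.card S : ℝ) *
            Real.exp (-x) ^ (t + 1) := Finset.sum_le_sum fun t _ =>
          hrun.measureReal_policy_ne_le hM hf hD hB hB0 hopt hother (Nat.le_add_left 1 t)
      _ ≤ (1 + (Fintype.card A : ℝ)) * (Fintype.card S : ℝ) * (1 / (Real.exp x - 1)) := by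
          rw [← Finset.mul_sum]
          exact mul_le_mul_of_nonneg_left (sum_range_exp_neg_pow_le hx0 n) (by positivity)
      _ = _ := by rw [mul_one_div]
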